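/- Let $N\ge 0$ be an integer and let $A=[A(i,j)]_{i,j=1}^N$ be a matrix with entries in $\{0,1\}$. Let $\mathcal O_A$ be the Cuntz–Krieger algebra of $A$, the universal unital $C^*$-algebra generated by partial isometries $t_1,\dots,t_N$ with $\sum_j t_jt_j^*=1$ and $t_i^*t_i=\sum_j A(i,j)t_jt_j^*$. Put $\Sigma=\{\alpha_1,\dots,\alpha_N\}\sqcup\{\beta_1,\dots,\beta_N\}$, $\varphi_A(\alpha_i)=t_i^*$, $\varphi_A(\beta_i)=t_i$. The topological Markov Dyck shift $D_A\subset\Sigma^{\mathbb Z}$ is the subshift whose forbidden words are the $\gamma_1\cdots\gamma_n$ with $\varphi_A(\gamma_1)\cdots\varphi_A(\gamma_n)=0$ in $\mathcal O_A$. For a subshift $\Lambda$ let $B_l(\Lambda)$ be the set of words of length $l$ that appear in points of $\Lambda$ and $B_*(\Lambda)=\bigcup_l B_l(\Lambda)$; call its elements admissible. For $\mu\in B_*(\Lambda)$ let $\Gamma_l^-(\mu)=\{\nu\in B_l(\Lambda): \nu\mu\in B_*(\Lambda)\}$, and let $S_l(\Lambda)$ be the set of $l$-synchronizing words, i.e.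 of $\mu\in B_*(\Lambda)$ such that $\Gamma_l^-(\mu)=\Gamma_l^-(\mu\omega)$ whenever $\omega,\mu\omega\in B_*(\Lambda)$. The synchronization condition for $\Lambda$ is: for all $l\le k$ and $\eta\in B_l(\Lambda)$ there is $\nu\in S_k(\Lambda)$ with $\eta\nu\in S_{k-l}(\Lambda)$. $\Lambda$ is irreducible if for all $\mu,\nu\in B_*(\Lambda)$ there is $\xi\in B_*(\Lambda)$ with $\mu\xi\nu\in B_*(\Lambda)$; $\Lambda$ is $\lambda$-synchronizing if it is irreducible and satisfies the synchronization condition. A (left-resolving) $\lambda$-graph system over $\Sigma$ consists of finite vertex sets $V_l$ and finite sets $E_{l,l+1}$ of $\Sigma$-labeled edges from $V_l$ to $V_{l+1}$ ($l\ge0$) with surjections $\iota:V_{l+1}\to V_l$, such that every vertex has an outgoing edge; every vertex of $V_{l+1}$ has an incoming edge; for $l\ge 1$, $v\in V_{l+1}$ and each label $a$, an edge labeled $a$ ends at $v$ if and only if one ends at $\iota(v)$; for $l\ge1$, $u\in V_{l-1}$, $v\in V_{l+1}$ there is a label-preserving bijection between the edges $e\in E_{l,l+1}$ with $t(e)=v$,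 $\iota(s(e))=u$ and the edges in $E_{l-1,l}$ from $u$ to $\iota(v)$; and distinct edges with the same label have distinct terminal vertices. It presents $\Lambda$ if $B_*(\Lambda)$ is the set of labels of its finite paths. An isomorphism consists of level-preserving bijections of vertices and of edges compatible with sources, terminals, labels and $\iota$. $\mathfrak L^{\lambda(\Lambda)}$ has as vertices at level $l$ the classes $[\mu]_l$ of $\mu\in S_l(\Lambda)$ under equality of $\Gamma_l^-$, one edge labeled $a$ from $[a\nu]_l$ to $[\nu]_{l+1}$ for $\nu\in S_{l+1}(\Lambda)$, $a\in\Gamma_1^-(\nu)$, and $\iota([\mu]_{l+1})=[\mu]_l$. The Cantor horizon system $\mathfrak L^{Ch(D_A)}$ has as vertices at level $l$ the $v_{\mu_1\cdots\mu_l}$ with $\beta_{\mu_1}\cdots\beta_{\mu_l}\in B_l(D_A)$; $\iota$ deletes the last letter; there is an edge labeled $\alpha_j$ from $v_{\mu_1\cdots\mu_l}$ to $v_{j\mu_1\cdots\mu_l}$ whenever both are vertices, and, whenever $\beta_j\beta_{\mu_1}\cdots\beta_{\mu_{l+1}}$ is admissible, an edge labeled $\beta_j$ to $v_{\mu_1\cdots\mu_{l+1}}$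 from the vertex indexed by the first $l$ letters of $j\mu_1\cdots\mu_{l+1}$; there are no other edges. **Proposition.** The subshift $D_A$ satisfies the synchronization condition; hence it is $\lambda$-synchronizing whenever it is irreducible, and this is the case if the matrix $A$ is irreducible. Moreover $\mathfrak L^{\lambda(D_A)}$ and $\mathfrak L^{Ch(D_A)}$ are $\lambda$-graph systems, $\mathfrak L^{Ch(D_A)}$ presents $D_A$, each $\beta_{\mu_1}\cdots\beta_{\mu_l}\in B_l(D_A)$ is $l$-synchronizing, and $v_{\mu_1\cdots\mu_l}\mapsto[\beta_{\mu_1}\cdots\beta_{\mu_l}]_l$ is the vertex map of an isomorphism $\mathfrak L^{Ch(D_A)}\cong\mathfrak L^{\lambda(D_A)}$. -/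

import Mathlib

open scoped ENNReal

/-! ## Words and languages of subshifts

A subshift over the alphabet `S` is Mathlib's `SymbolicDynamics.FullShift.Subshift S ℤ`: a closed
subset of `ℤ → S` that is invariant under all integer shifts. Words are lists. -/

namespace SubshiftWords

open SymbolicDynamics.FullShift

variable {S : Type*}

/-- The word `x n, x (n + 1), …, x (n + k - 1)` of length `k` read in the sequence `x`. -/
def factor (x : ℤ → S) (n : ℤ) (k : ℕ) : List S :=
  List.ofFn fun i : Fin k => x (n + ((i : ℕ) : ℤ))

/-- The set of sequences all of whose finite factors avoid the set `F` of forbidden words. -/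
def avoiding (F : Set (List S)) : Set (ℤ → S) :=
  {x | ∀ (n : ℤ) (k : ℕ), factor x n k ∉ F}

lemma isClosed_avoiding [TopologicalSpace S] [DiscreteTopology S] (F : Set (List S)) :
    IsClosed (avoiding F) := by
  have h : avoiding F = ⋂ (n : ℤ) (k : ℕ), {x : ℤ → S | factor x n k ∈ Fᶜ} := by
    ext x
    simp [avoiding]
  rw [h]
  refine isClosed_iInter fun n => isClosed_iInter fun k => ?_
  exact IsClosed.preimage (f := fun (x : ℤ → S) (i : Fin k) => x (n + ((i : ℕ) : ℤ)))
    (t := {w | List.ofFn w ∈ Fᶜ}) (by fun_prop) (isClosed_discrete _)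

/-- The subshift over `S` whose forbidden words are the words in `F`. -/
def ofForbiddenWords [TopologicalSpace S] [DiscreteTopology S] (F : Set (List S)) :
    Subshift S ℤ where
  carrier := avoiding F
  isClosed := isClosed_avoiding F
  mapsTo := by
    intro g x hx n k
    have h : factor (shift g x) n k = factor x (g + n) k := by
      simp [factor, shift, add_assoc]
    rw [h]
    exact hx _ _

variable [TopologicalSpace S]

/-- `B_*(Λ)`: the words (of any length) that appear in some point of `Λ`. -/
def language (L : Subshift S ℤ) : Set (List S) :=
  {w | ∃ x ∈ L.carrier, ∃ n : ℤ, factor x n w.length = w}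

/-- `B_l(Λ)`: the words of length `l` that appear in some point of `Λ`. -/
def wordsOfLength (L : Subshift S ℤ) (l : ℕ) : Set (List S) :=
  {w | w ∈ language L ∧ w.length = l}

/-- `Γ_l^-(μ)`: the words of length `l` that may precede `μ`. -/
def predecessors (L : Subshift S ℤ) (l : ℕ) (μ : List S) : Set (List S) :=
  {ν | ν ∈ wordsOfLength L l ∧ ν ++ μ ∈ language L}

/-- `Γ_*^+(μ)`: the words of any length that may follow `μ`. -/
def followers (L : Subshift S ℤ) (μ : List S) : Set (List S) :=
  {ω | ω ∈ language L ∧ μ ++ ω ∈ language L}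

/-- `S_l(Λ)`: the `l`-synchronizing words of `Λ`. -/
def syncWords (L : Subshift S ℤ) (l : ℕ) : Set (List S) :=
  {μ | μ ∈ language L ∧
    ∀ ω ∈ followers L μ, predecessors L l μ = predecessors L l (μ ++ ω)}

/-- Irreducibility of a subshift: any two admissible words can be connected by a third one. -/
def IsIrreducibleSubshift (L : Subshift S ℤ) : Prop :=
  ∀ μ ∈ language L, ∀ ν ∈ language L, ∃ ξ ∈ language L, μ ++ ξ ++ ν ∈ language L

/-- The synchronization condition: for `η ∈ B_l(Λ)` and `k ≥ l` there is `ν ∈ S_k(Λ)` such that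
`ην ∈ S_{k-l}(Λ)`. -/
def LambdaSyncCondition (L : Subshift S ℤ) : Prop :=
  ∀ l k : ℕ, l ≤ k → ∀ η ∈ wordsOfLength L l,
    ∃ ν ∈ syncWords L k, η ++ ν ∈ syncWords L (k - l)

/-- A `λ`-synchronizing subshift: irreducible and satisfying the synchronization condition. -/
def IsLambdaSynchronizing (L : Subshift S ℤ) : Prop :=
  IsIrreducibleSubshift L ∧ LambdaSyncCondition L

end SubshiftWords

/-! ## `λ`-graph systems -/

/-- A labeled Bratteli diagram over the alphabet `S` with maps `ι : V (l + 1) → V l`. Edges in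
`E l` go from `V l` to `V (l + 1)`. -/
structure LabeledBratteli (S : Type*) where
  V : ℕ → Type
  E : ℕ → Type
  src : ∀ {l : ℕ}, E l → V l
  tgt : ∀ {l : ℕ}, E l → V (l + 1)
  label : ∀ {l : ℕ}, E l → S
  iota : ∀ {l : ℕ}, V (l + 1) → V l

namespace LabeledBratteli

variable {S : Type*}

/-- The axioms of a left-resolving `λ`-graph system. -/
structure IsLambdaGraphSystem (G : LabeledBratteli S) : Prop where
  finite_V : ∀ l, Finite (G.V l)
  finite_E : ∀ l, Finite (G.E l)
  iota_surjective : ∀ l, Function.Surjective (G.iota : G.V (l + 1) → G.V l)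
  exists_successor : ∀ l (v : G.V l), ∃ e : G.E l, G.src e = v
  exists_predecessor : ∀ l (v : G.V (l + 1)), ∃ e : G.E l, G.tgt e = v
  incoming_label_iff : ∀ l (v : G.V (l + 2)) (a : S),
    (∃ e : G.E (l + 1), G.label e = a ∧ G.tgt e = v) ↔
      ∃ e : G.E l, G.label e = a ∧ G.tgt e = G.iota v
  local_property : ∀ l (u : G.V l) (v : G.V (l + 2)),
    ∃ f : {e : G.E (l + 1) // G.tgt e = v ∧ G.iota (G.src e) = u} ≃
        {e : G.E l // G.src e = u ∧ G.tgt e = G.iota v},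
      ∀ e, G.label (f e).1 = G.label e.1
  left_resolving : ∀ l (e f : G.E l), G.label e = G.label f → G.tgt e = G.tgt f → e = f

/-- `G.Leaves w v`: some labeled path with label `w` starts at the vertex `v`. -/
def Leaves (G : LabeledBratteli S) : List S → ∀ {l : ℕ}, G.V l → Prop
  | [], _, _ => True
  | a :: w, _, v => ∃ e, G.src e = v ∧ G.label e = a ∧ G.Leaves w (G.tgt e)

/-- `G` presents `L`: the admissible words of `L` are the labels of the finite paths of `G`. -/
def Presents [TopologicalSpace S] (G : LabeledBratteli S)
    (L : SymbolicDynamics.FullShift.Subshift S ℤ) : Prop :=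
  ∀ w : List S, w ∈ SubshiftWords.language L ↔ ∃ (l : ℕ) (v : G.V l), G.Leaves w v

/-- Isomorphism: level-preserving bijections of vertices and of edges that respect sources,
terminals, labels and the maps `ι`. -/
structure Iso (G H : LabeledBratteli S) where
  onV : ∀ l, G.V l ≃ H.V l
  onE : ∀ l, G.E l ≃ H.E l
  src_comm : ∀ l (e : G.E l), H.src (onE l e) = onV l (G.src e)
  tgt_comm : ∀ l (e : G.E l), H.tgt (onE l e) = onV (l + 1) (G.tgt e)
  label_comm : ∀ l (e : G.E l), H.label (onE l e) = G.label e
  iota_comm : ∀ l (v : G.V (l + 1)), H.iota (onV (l + 1) v) = onV l (G.iota v)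

end LabeledBratteli

/-! ## The canonical `λ`-synchronizing `λ`-graph system `𝔏^{λ(Λ)}` -/

namespace SubshiftWords

open SymbolicDynamics.FullShift

variable {S : Type} [TopologicalSpace S]

/-- `l`-past equivalence on the `l`-synchronizing words. -/
def pastSetoid (L : Subshift S ℤ) (l : ℕ) : Setoid (syncWords L l) where
  r μ ν := predecessors L l μ.1 = predecessors L l ν.1
  iseqv := ⟨fun _ => rfl, fun h => h.symm, fun h h' => h.trans h'⟩

/-- The `l`-past equivalence classes of `S_l(Λ)`. -/
def SyncClass (L : Subshift S ℤ) (l : ℕ) : Type := Quotient (pastSetoid L l)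

/-- The class `[μ]_l` of `μ ∈ S_l(Λ)`. -/
def syncClass (L : Subshift S ℤ) (l : ℕ) (μ : List S) (h : μ ∈ syncWords L l) : SyncClass L l :=
  Quotient.mk (pastSetoid L l) ⟨μ, h⟩

lemma mem_language_of_append_left {L : Subshift S ℤ} {μ ω : List S}
    (h : μ ++ ω ∈ language L) : μ ∈ language L := by
  obtain ⟨x, hx, n, hn⟩ := h
  refine ⟨x, hx, n, ?_⟩
  apply List.ext_getElem (by simp [factor])
  intro i h1 h2
  have h3 := List.getElem_of_eq hn (i := i) (by simp [factor]; omega)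
  rw [List.getElem_append_left h2] at h3
  simpa [factor] using h3

lemma mem_language_of_append_right {L : Subshift S ℤ} {μ ω : List S}
    (h : μ ++ ω ∈ language L) : ω ∈ language L := by
  obtain ⟨x, hx, n, hn⟩ := h
  refine ⟨x, hx, n + μ.length, ?_⟩
  apply List.ext_getElem (by simp [factor])
  intro i h1 h2
  have h3 := List.getElem_of_eq hn (i := μ.length + i) (by simp [factor]; omega)
  rw [List.getElem_append_right (by omega)] at h3
  simpa [factor, add_assoc] using h3

lemma mem_predecessors_iff {L : Subshift S ℤ} {l : ℕ} {μ ν : List S} :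
    ν ∈ predecessors L l μ ↔ ν.length = l ∧ ν ++ μ ∈ language L :=
  ⟨fun h => ⟨h.1.2, h.2⟩, fun h => ⟨⟨mem_language_of_append_left h.2, h.1⟩, h.2⟩⟩

/-- `∼_{l+1}` refines `∼_l`. -/
lemma predecessors_eq_of_succ {L : Subshift S ℤ} {l : ℕ} {μ ν : List S}
    (h : predecessors L (l + 1) μ = predecessors L (l + 1) ν) :
    predecessors L l μ = predecessors L l ν := by
  have key : ∀ {μ ν : List S}, predecessors L (l + 1) μ = predecessors L (l + 1) ν →
      predecessors L l μ ⊆ predecessors L l ν := by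
    intro μ ν h w hw
    rw [mem_predecessors_iff] at hw ⊢
    refine ⟨hw.1, ?_⟩
    obtain ⟨x, hx, n, hn⟩ := hw.2
    have h1 : x (n - 1) :: w ∈ predecessors L (l + 1) μ := by
      rw [mem_predecessors_iff]
      refine ⟨by simp [hw.1], x, hx, n - 1, ?_⟩
      rw [List.cons_append, List.length_cons]
      conv_rhs => rw [← hn]
      simp only [factor, List.ofFn_succ]
      congr 1
      · simp
      · congr 1
        funext i
        congr 1
        push_cast [Fin.val_succ]
        ring
    rw [h, mem_predecessors_iff] at h1
    exact mem_language_of_append_right (μ := [x (n - 1)]) (by simpa using h1.2)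
  exact Set.Subset.antisymm (key h) (key h.symm)

lemma syncWords_succ_subset (L : Subshift S ℤ) (l : ℕ) : syncWords L (l + 1) ⊆ syncWords L l :=
  fun _ hμ => ⟨hμ.1, fun ω hω => predecessors_eq_of_succ (hμ.2 ω hω)⟩

/-- The labeled Bratteli diagram `𝔏^{λ(Λ)}`: its vertices at level `l` are the `l`-past equivalence
classes of `l`-synchronizing words, and for `ν ∈ S_{l+1}(Λ)` and `a ∈ Γ_1^-(ν)` there is exactly
one edge labeled `a` from `[aν]_l` to `[ν]_{l+1}`. The map `ι` sends `[μ]_{l+1}` to `[μ]_l`. -/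
def syncGraph (L : Subshift S ℤ) : LabeledBratteli S where
  V l := SyncClass L l
  E l := {e : SyncClass L l × S × SyncClass L (l + 1) //
    ∃ (ν : List S) (hν : ν ∈ syncWords L (l + 1)) (_ : [e.2.1] ∈ predecessors L 1 ν)
      (h : e.2.1 :: ν ∈ syncWords L l),
      e.1 = syncClass L l (e.2.1 :: ν) h ∧ e.2.2 = syncClass L (l + 1) ν hν}
  src e := e.1.1
  tgt e := e.1.2.2
  label e := e.1.2.1
  iota {l} := Quotient.lift
    (fun μ : syncWords L (l + 1) => syncClass L l μ.1 (syncWords_succ_subset L l μ.2))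
    (fun _ _ h => Quotient.sound (s := pastSetoid L l) (predecessors_eq_of_succ h))

end SubshiftWords

/-! ## The Cuntz–Krieger algebra -/

noncomputable section

namespace CuntzKrieger

variable {N : ℕ}

/-- A family of partial isometries in a unital `C⋆`-algebra that satisfies the Cuntz–Krieger
relations of the matrix `A`. -/
structure IsFamily (A : Matrix (Fin N) (Fin N) ℤ) {B : Type*} [CStarAlgebra B]
    (t : Fin N → B) : Prop where
  partialIsometry : ∀ i, t i * star (t i) * t i = t i
  sum_range : ∑ j, t j * star (t j) = 1
  source : ∀ i, star (t i) * t i = ∑ j, A i j • (t j * star (t j))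

/-- A Cuntz–Krieger family for `A` together with the nonzero unital `C⋆`-algebra it lives in. -/
structure Model (A : Matrix (Fin N) (Fin N) ℤ) where
  carrier : Type
  [cstar : CStarAlgebra carrier]
  [nontriv : Nontrivial carrier]
  t : Fin N → carrier
  isFamily : IsFamily A t

attribute [instance] Model.cstar Model.nontriv

variable (A : Matrix (Fin N) (Fin N) ℤ)

/-- The `C⋆`-algebra of bounded elements of the product of all models. -/
abbrev Ambient : Type 1 := lp (fun r : Model A => r.carrier) ∞

instance : CStarAlgebra (Ambient A) where

variable {A}

lemma IsFamily.norm_le_one {B : Type*} [CStarAlgebra B] {t : Fin N → B}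
    (h : IsFamily A t) (i : Fin N) : ‖t i‖ ≤ 1 := by
  have h1 : ‖t i‖ * ‖t i‖ = ‖star (t i) * t i‖ := CStarRing.norm_star_mul_self.symm
  have h2 : (star (t i) * t i) * (star (t i) * t i) = star (t i) * t i := by
    have := h.partialIsometry i
    calc _ = star (t i) * (t i * star (t i) * t i) := by simp only [mul_assoc]
      _ = _ := by rw [this]
  have h3 : ‖star (t i) * t i‖ ≤ 1 := by
    have h4 : ‖star (t i) * t i‖ * ‖star (t i) * t i‖ = ‖star (t i) * t i‖ := by
      rw [← CStarRing.norm_star_mul_self]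
      simp [h2]
    nlinarith [norm_nonneg (star (t i) * t i)]
  nlinarith [norm_nonneg (t i)]

variable (A)

/-- The family of the generators of all models. -/
def ambientGen (i : Fin N) : Ambient A :=
  ⟨fun r => r.t i, memℓp_infty ⟨1, by rintro _ ⟨r, rfl⟩; exact r.isFamily.norm_le_one i⟩⟩

/-- The Cuntz–Krieger algebra `𝓞_A`, i.e. the universal unital `C⋆`-algebra generated by a
Cuntz–Krieger family for `A`: the closed unital `⋆`-subalgebra generated by the universal family
in the product of all models. See `gen_isFamily` and `existsUnique_lift`. Models in `Type` suffice:
a `C⋆`-algebra generated by finitely many elements has at most the cardinality of the continuum. -/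
def algebra : StarSubalgebra ℂ (Ambient A) :=
  (StarAlgebra.adjoin ℂ (Set.range (ambientGen A))).topologicalClosure

instance : CStarAlgebra (algebra A) :=
  StarSubalgebra.cstarAlgebra (algebra A)
    (h_closed := StarSubalgebra.isClosed_topologicalClosure _)

/-- The canonical generators `t_1, …, t_N` of `𝓞_A`. -/
def gen (i : Fin N) : algebra A :=
  ⟨ambientGen A i, StarSubalgebra.le_topologicalClosure _
    (StarAlgebra.subset_adjoin ℂ _ ⟨i, rfl⟩)⟩

lemma ambientGen_isFamily : IsFamily A (ambientGen A) where
  partialIsometry i := by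
    ext r
    exact r.isFamily.partialIsometry i
  sum_range := by
    ext r
    rw [lp.coeFn_sum, Finset.sum_apply]
    exact r.isFamily.sum_range
  source i := by
    ext r
    rw [lp.coeFn_sum, Finset.sum_apply]
    exact r.isFamily.source i

theorem gen_isFamily : IsFamily A (gen A) where
  partialIsometry i := Subtype.ext ((ambientGen_isFamily A).partialIsometry i)
  sum_range := Subtype.ext (by
    simpa [gen] using (ambientGen_isFamily A).sum_range)
  source i := Subtype.ext (by
    simpa [gen] using (ambientGen_isFamily A).source i)

/-- The projection of the product of all models to one of them. -/
def ambientProj (r : Model A) : Ambient A →⋆ₐ[ℂ] r.carrier where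
  toFun f := f r
  map_one' := rfl
  map_mul' _ _ := rfl
  map_zero' := rfl
  map_add' _ _ := rfl
  commutes' _ := rfl
  map_star' _ := rfl

/-- The universal property of `𝓞_A`. -/
theorem existsUnique_lift {B : Type} [CStarAlgebra B] {s : Fin N → B} (hs : IsFamily A s) :
    ∃! φ : algebra A →⋆ₐ[ℂ] B, ∀ i, φ (gen A i) = s i := by
  rcases subsingleton_or_nontrivial B with hB | hB
  · let φ₀ : algebra A →⋆ₐ[ℂ] B :=
      { toFun := fun _ => 0
        map_one' := Subsingleton.elim _ _
        map_mul' := fun _ _ => Subsingleton.elim _ _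
        map_zero' := rfl
        map_add' := fun _ _ => Subsingleton.elim _ _
        commutes' := fun _ => Subsingleton.elim _ _
        map_star' := fun _ => Subsingleton.elim _ _ }
    refine ⟨φ₀, fun _ => Subsingleton.elim _ _, ?_⟩
    intro φ _
    ext x
    exact Subsingleton.elim _ _
  · let r : Model A := ⟨B, s, hs⟩
    refine ⟨(ambientProj A r).comp (algebra A).subtype, fun _ => rfl, ?_⟩
    intro φ hφ
    have hc : Continuous φ := AddMonoidHomClass.continuous_of_bound φ 1 fun x => by
      simpa using NonUnitalStarAlgHom.norm_apply_le φ x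
    have hc' : Continuous ((ambientProj A r).comp (algebra A).subtype) :=
      AddMonoidHomClass.continuous_of_bound _ 1 fun x => by
        simpa using NonUnitalStarAlgHom.norm_apply_le
          ((ambientProj A r).comp (algebra A).subtype) x
    refine StarAlgHom.ext_topologicalClosure hc hc' (StarAlgHom.ext_adjoin ?_)
    rintro ⟨x, hx⟩ ⟨i, rfl⟩
    exact hφ i

end CuntzKrieger

/-! ## Topological Markov Dyck shifts and their Cantor horizon `λ`-graph systems -/

namespace MarkovDyck

open SymbolicDynamics.FullShift SubshiftWords

variable {N : ℕ}

/-- The alphabet `Σ = Σ⁻ ⊔ Σ⁺`. -/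
abbrev Symbol (N : ℕ) : Type := Fin N ⊕ Fin N

/-- The symbols `α_1, …, α_N` of `Σ⁻`. -/
abbrev alpha (i : Fin N) : Symbol N := Sum.inl i

/-- The symbols `β_1, …, β_N` of `Σ⁺`. -/
abbrev beta (i : Fin N) : Symbol N := Sum.inr i

variable (A : Matrix (Fin N) (Fin N) ℤ)

/-- `φ_A(α_i) = t_i⋆` and `φ_A(β_i) = t_i`. -/
def phi : Symbol N → CuntzKrieger.algebra A
  | Sum.inl i => star (CuntzKrieger.gen A i)
  | Sum.inr i => CuntzKrieger.gen A i

/-- `𝔉_A`: the words `γ_1 ⋯ γ_n` with `φ_A(γ_1) ⋯ φ_A(γ_n) = 0` in `𝓞_A`. -/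
def forbidden : Set (List (Symbol N)) :=
  {w | (w.map (phi A)).prod = 0}

/-- The topological Markov Dyck shift `D_A`. -/
def dyckShift : Subshift (Symbol N) ℤ := ofForbiddenWords (forbidden A)

/-- The index words `μ_1 ⋯ μ_l` for which `β_{μ_1} ⋯ β_{μ_l} ∈ B_l(D_A)`. -/
def plusWords (l : ℕ) : Set (List (Fin N)) :=
  {μ | μ.map beta ∈ wordsOfLength (dyckShift A) l}

variable {A} in
lemma take_mem_plusWords {k l : ℕ} (hkl : k ≤ l) {μ : List (Fin N)} (h : μ ∈ plusWords A l) :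
    μ.take k ∈ plusWords A k := by
  have hl : μ.length = l := by simpa using h.2
  refine ⟨mem_language_of_append_left (ω := (μ.drop k).map beta) ?_, by simp; omega⟩
  rw [← List.map_append, List.take_append_drop]
  exact h.1

/-- The Cantor horizon `λ`-graph system `𝔏^{Ch(D_A)}`. The vertices `v_μ` at level `l` are the
admissible words `β_{μ_1} ⋯ β_{μ_l}`, and `ι` deletes the rightmost symbol. There is one edge labeled
`α_j` from `v_{μ_1 ⋯ μ_l}` to `v_{j μ_1 ⋯ μ_l}`, and, whenever `β_j β_{μ_1} ⋯ β_{μ_{l+1}}` is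
admissible, one edge labeled `β_j` from the vertex of the first `l` letters of
`j μ_1 ⋯ μ_{l+1}` to `v_{μ_1 ⋯ μ_{l+1}}`. -/
def cantorHorizon : LabeledBratteli (Symbol N) where
  V l := plusWords A l
  E l := {e : plusWords A l × Symbol N × plusWords A (l + 1) //
    (∃ j, e.2.1 = alpha j ∧ e.2.2.1 = j :: e.1.1) ∨
    (∃ j, e.2.1 = beta j ∧ j :: e.2.2.1 ∈ plusWords A (l + 2) ∧
      e.1.1 = (j :: e.2.2.1).take l)}
  src e := e.1.1
  tgt e := e.1.2.2
  label e := e.1.2.1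
  iota {l} v := ⟨v.1.take l, take_mem_plusWords (Nat.le_succ l) v.2⟩

end MarkovDyck

end

/-!
Everything follows from calculations with the generators `t_j` of `𝓞_A`. Compressing
`∑ t_k t_k⋆ = 1` shows that the range projections are orthogonal, so `t_i⋆ t_i t_j = A i j • t_j`.
By `∑ t_k t_k⋆ = 1` again, a word with nonzero value can always be continued by some `α_j` on the
left and some `β_k` on the right, so the admissible words of `D_A` are exactly the words with nonzero
value in `𝓞_A` (`mem_language_iff`). In particular synchronization and pasts depend only on values.
No faithful representation of `𝓞_A` is needed, and for `𝓞_A = 0` the shift is empty.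

Write `t_μ` for the value of `β_μ = β_{μ_1} ⋯ β_{μ_l}`. Multiplying a nonempty path `t_μ` from the left
by `t_j` or `t_j⋆` without getting zero prepends or removes a letter and can be undone by multiplying
by the adjoint (`star_phi_mul_cancel`). Two facts result for a word `w` that is not longer than `μ`
and has `φ(w) t_μ ≠ 0`. There is `c` with `c φ(w) t_μ = t_μ`, so `φ(w) t_μ φ(ω) = 0` forces
`t_μ φ(ω) = 0`: hence `β_μ` is `l`-synchronizing for `l ≤ |μ|` (`map_beta_mem_syncWords`). And if `w`
is strictly shorter than `μ`, then `φ(w) t_μ` is again a path `t_ξ` (`exists_wordValue_mul_pathValue`),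
so every admissible word can be continued to a word with the value of a path that is as long as
desired (`exists_append_beta`). This gives the synchronization condition and, since the `l`-past of
`β_ξ` is that of its first `l` letters, also the surjectivity of `v_μ ↦ [β_μ]_l`. Injectivity holds as
`t_ν⋆ t_μ = 0` for different `μ`, `ν` of the same length. Continuing a synchronizing word changes
neither its class nor the labels that may precede it, which identifies the edges
(`cantorHorizon_edge_iff`). The axioms of a `λ`-graph system are checked for the Cantor horizon system,
where edges are explicit, and transported along the isomorphism. For irreducible `A` all `t_j` are
nonzero and two paths can be joined, which connects the path obtained from one word to the adjoint of
the path obtained from the adjoint of the other.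
-/

/-! ### Cuntz–Krieger relations -/

namespace CuntzKrieger.IsFamily

variable {N : ℕ} {A : Matrix (Fin N) (Fin N) ℤ} {B : Type*} [CStarAlgebra B] {t : Fin N → B}

/-- The range projections are pairwise orthogonal: compressing `∑ t_k t_k⋆ = 1` by `t_j` shows that
the positive elements `t_j⋆ t_k t_k⋆ t_j` with `k ≠ j` add up to zero. -/
lemma star_mul_eq_zero (F : IsFamily A t) {i j : Fin N} (hij : i ≠ j) :
    star (t i) * t j = 0 := by
  let _ := CStarAlgebra.spectralOrder B
  let _ := CStarAlgebra.spectralOrderedRing B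
  have h1 : ∑ k, star (star (t k) * t j) * (star (t k) * t j) = star (t j) * t j := by
    calc _ = star (t j) * (∑ k, t k * star (t k)) * t j := by
          simp only [Finset.mul_sum, Finset.sum_mul, star_mul, star_star, mul_assoc]
      _ = _ := by rw [F.sum_range, mul_one]
  rw [← Finset.add_sum_erase _ _ (Finset.mem_univ j)] at h1
  have h2 : star (star (t j) * t j) * (star (t j) * t j) = star (t j) * t j := by
    have := F.partialIsometry j
    calc _ = star (t j) * (t j * star (t j) * t j) := by
          simp only [star_mul, star_star, mul_assoc]
      _ = _ := by rw [this]
  rw [h2, add_eq_left, Finset.sum_eq_zero_iff_of_nonneg fun _ _ => star_mul_self_nonneg _] at h1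
  exact CStarRing.star_mul_self_eq_zero_iff _ |>.1 (h1 i (by simp [hij]))

lemma source_mul (F : IsFamily A t) (i j : Fin N) :
    star (t i) * t i * t j = A i j • t j := by
  rw [F.source, Finset.sum_mul, Finset.sum_eq_single j]
  · rw [smul_mul_assoc, F.partialIsometry]
  · intro k _ hk
    rw [smul_mul_assoc, mul_assoc, F.star_mul_eq_zero hk, mul_zero, smul_zero]
  · simp

lemma mul_eq_smul (F : IsFamily A t) (i j : Fin N) : t i * t j = A i j • (t i * t j) := by
  conv_lhs => rw [← F.partialIsometry i, mul_assoc, mul_assoc, ← mul_assoc (star _), F.source_mul,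
    mul_smul_comm]

lemma entry_ne_zero (F : IsFamily A t) {i j : Fin N} {y : B} (h : t i * (t j * y) ≠ 0) :
    A i j ≠ 0 := by
  intro h0
  rw [← mul_assoc, F.mul_eq_smul, h0, zero_smul, zero_mul] at h
  exact h rfl

lemma star_mul_mul_cancel (F : IsFamily A t) {i j : Fin N} (h : A i j = 1) (y : B) :
    star (t i) * (t i * (t j * y)) = t j * y := by
  rw [← mul_assoc, ← mul_assoc, F.source_mul, h, one_smul]

lemma exists_mul_ne_zero (F : IsFamily A t) {x : B} (h : x ≠ 0) : ∃ j, x * t j ≠ 0 := by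
  by_contra! h0
  apply h
  rw [← mul_one x, ← F.sum_range, Finset.mul_sum]
  exact Finset.sum_eq_zero fun j _ => by rw [← mul_assoc, h0, zero_mul]

lemma exists_star_mul_ne_zero (F : IsFamily A t) {x : B} (h : x ≠ 0) :
    ∃ j, star (t j) * x ≠ 0 := by
  by_contra! h0
  apply h
  rw [← one_mul x, ← F.sum_range, Finset.sum_mul]
  exact Finset.sum_eq_zero fun j _ => by rw [mul_assoc, h0, mul_zero]

lemma exists_mul_prod_ne_zero (F : IsFamily A t) {x : B} (h : x ≠ 0) (n : ℕ) :
    ∃ μ : List (Fin N), μ.length = n ∧ x * (μ.map t).prod ≠ 0 := by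
  induction n generalizing x with
  | zero => exact ⟨[], rfl, by simpa using h⟩
  | succ n ih =>
    obtain ⟨j, hj⟩ := F.exists_mul_ne_zero h
    obtain ⟨μ, hμ, h'⟩ := ih hj
    exact ⟨j :: μ, by simp [hμ], by simpa [mul_assoc] using h'⟩

/-- Prepending a letter to a path only involves its first letter. -/
lemma prod_cons_ne_zero (F : IsFamily A t) (hA : ∀ i j, A i j = 0 ∨ A i j = 1) {i j : Fin N}
    {μ ν : List (Fin N)} (h : ((i :: j :: μ).map t).prod ≠ 0)
    (hν : ((j :: ν).map t).prod ≠ 0) : ((i :: j :: ν).map t).prod ≠ 0 := by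
  simp only [List.map_cons, List.prod_cons] at h hν ⊢
  intro h0
  rw [← F.star_mul_mul_cancel ((hA i j).resolve_left (F.entry_ne_zero h)), h0, mul_zero] at hν
  exact hν rfl

/-- The source projection of a nonzero path is that of its last letter. -/
lemma star_prod_mul_prod (F : IsFamily A t) (hA : ∀ i j, A i j = 0 ∨ A i j = 1)
    {μ : List (Fin N)} {j : Fin N} (h : ((μ ++ [j]).map t).prod ≠ 0) :
    star ((μ ++ [j]).map t).prod * ((μ ++ [j]).map t).prod = star (t j) * t j := by
  induction μ with
  | nil => simp
  | cons i μ ih =>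
    obtain ⟨k, ρ, hρ⟩ : ∃ k ρ, μ ++ [j] = k :: ρ := by cases μ <;> simp
    rw [List.cons_append, List.map_cons, List.prod_cons] at h ⊢
    have h' := right_ne_zero_of_mul h
    rw [star_mul, mul_assoc]
    conv_lhs => rw [hρ, List.map_cons, List.prod_cons]
    rw [hρ, List.map_cons, List.prod_cons] at h
    rw [F.star_mul_mul_cancel ((hA _ _).resolve_left (F.entry_ne_zero h)), ← List.prod_cons,
      ← List.map_cons, ← hρ]
    exact ih h'

lemma gen_ne_zero_of_entry (F : IsFamily A t) {i j : Fin N} (h : A i j = 1) (hj : t j ≠ 0) :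
    t i ≠ 0 := by
  intro h0
  have := F.source_mul i j
  simp [h0, h] at this
  exact hj this.symm

/-- For irreducible `A` a path between two given letters can be inserted. -/
lemma exists_connecting_path (F : IsFamily A t) (hA : ∀ i j, A i j = 0 ∨ A i j = 1)
    (hirr : A.IsIrreducible) {μ : List (Fin N)} {i : Fin N}
    (h : ((μ ++ [i]).map t).prod ≠ 0) (j : Fin N) :
    ∃ ρ, ((μ ++ [i] ++ ρ ++ [j]).map t).prod ≠ 0 := by
  let _ := A.toQuiver
  have hstep : ∀ {a b : Fin N}, (a ⟶ b) → A a b = 1 := fun {a b} e =>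
    (hA a b).resolve_left (ne_of_gt e.down)
  have back : ∀ {a b : Fin N}, Quiver.Path a b → t b ≠ 0 → t a ≠ 0 := by
    intro a b p
    induction p with
    | nil => exact id
    | cons p e ih => exact fun hb => ih (F.gen_ne_zero_of_entry (hstep e) hb)
  have hgen : ∀ k, t k ≠ 0 := by
    intro k
    obtain ⟨p, -⟩ := hirr.connected k i
    rw [List.map_append, List.prod_append] at h
    exact back p (by simpa using right_ne_zero_of_mul h)
  obtain ⟨p, hp⟩ := hirr.connected i j
  have key : ∀ {k : Fin N} (p : Quiver.Path i k), 0 < p.length →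
      ∃ ρ, ((μ ++ [i] ++ ρ ++ [k]).map t).prod ≠ 0 := by
    have ext : ∀ {ν : List (Fin N)} {a b : Fin N}, (a ⟶ b) → ((ν ++ [a]).map t).prod ≠ 0 →
        ((ν ++ [a] ++ [b]).map t).prod ≠ 0 := by
      intro ν a b e hν h0
      have h1 := congrArg (star ((ν ++ [a]).map t).prod * ·) h0
      rw [List.map_append (l₁ := ν ++ [a]), List.prod_append] at h1
      simp only [mul_zero] at h1
      rw [← mul_assoc, F.star_prod_mul_prod hA hν] at h1
      simp only [List.map_cons, List.map_nil, List.prod_singleton] at h1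
      rw [F.source_mul, hstep e, one_smul] at h1
      exact hgen b h1
    intro k p
    induction p with
    | nil => simp
    | @cons b c p e ih =>
      intro _
      rcases Nat.eq_zero_or_pos p.length with h0 | h0
      · obtain rfl := Quiver.Path.eq_of_length_zero p h0
        exact ⟨[], by simpa using ext e h⟩
      · obtain ⟨ρ, hρ⟩ := ih h0
        exact ⟨ρ ++ [b], by simpa using ext e hρ⟩
  exact key p hp

end CuntzKrieger.IsFamily

/-! ### Extending words to bi-infinite sequences -/

namespace SubshiftWords

/-- A factor-closed set of words, all of which extend simultaneously to the left and to the right,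
consists of factors of bi-infinite sequences all of whose factors lie in the set. -/
lemma exists_sequence_of_extendable {S : Type*} {P : List S → Prop}
    (hfac : ∀ u v w, P (u ++ v ++ w) → P v) (hext : ∀ w, P w → ∃ a b, P (a :: (w ++ [b])))
    {w : List S} (hw : P w) :
    ∃ x : ℤ → S, (∀ n k, P (factor x n k)) ∧ factor x 0 w.length = w := by
  obtain ⟨s₀, -⟩ := hext w hw
  have : Nonempty S := ⟨s₀⟩
  choose! a b hab using hext
  let W : ℕ → List S := fun n => (fun u => a u :: (u ++ [b u]))^[n] w
  have hW : ∀ n, W (n + 1) = a (W n) :: (W n ++ [b (W n)]) := fun n =>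
    Function.iterate_succ_apply' _ _ _
  have hlen : ∀ n, (W n).length = w.length + 2 * n := by
    intro n
    induction n with
    | zero => rfl
    | succ n ih => rw [hW]; simp [ih]; omega
  have hP : ∀ n, P (W n) := by
    intro n
    induction n with
    | zero => exact hw
    | succ n ih => rw [hW]; exact hab _ ih
  have hshift : ∀ m n k, k < w.length + 2 * n → (W (n + m))[k + m]? = (W n)[k]? := by
    intro m n k hk
    induction m with
    | zero => rfl
    | succ m ih =>
      rw [← add_assoc, ← add_assoc, hW, List.getElem?_cons_succ,
        List.getElem?_append_left (by rw [hlen]; omega), ih]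
  -- The letter at position `i` is read off from a word `W m` that is large enough to cover `i`.
  let x : ℤ → S := fun i => (W (i.natAbs + 1))[(i + (i.natAbs + 1 : ℕ)).toNat]?.getD s₀
  have hx : ∀ n k, k < w.length + 2 * n → (W n)[k]? = some (x ((k : ℤ) - n)) := by
    intro n k hk
    have hsome : ∀ m j, j < w.length + 2 * m → (W m)[j]? = some ((W m)[j]?.getD s₀) := by
      intro m j hj
      rw [List.getElem?_eq_getElem (by rw [hlen]; exact hj)]
      rfl
    rw [hsome n k hk]
    have h1 := hshift (((k : ℤ) - n).natAbs + 1) n k hk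
    have h2 := hshift n (((k : ℤ) - n).natAbs + 1)
      (((k : ℤ) - n) + (((k : ℤ) - n).natAbs + 1 : ℕ)).toNat (by omega)
    rw [add_comm _ n, show (((k : ℤ) - n) + (((k : ℤ) - n).natAbs + 1 : ℕ)).toNat + n =
      k + (((k : ℤ) - n).natAbs + 1) by omega, h1] at h2
    rw [h2]
  refine ⟨x, fun n k => ?_, ?_⟩
  · let m := n.natAbs + k
    have h : factor x n k = ((W m).drop (n + m).toNat).take k := by
      apply List.ext_getElem?
      intro i
      by_cases hi : i < k
      · rw [List.getElem?_take_of_lt hi, List.getElem?_drop, hx _ _ (by omega),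
          List.getElem?_eq_getElem (by simpa [factor] using hi)]
        simp only [factor, List.getElem_ofFn]
        congr 2
        push_cast
        omega
      · rw [List.getElem?_eq_none (by simp [factor]; omega),
          List.getElem?_eq_none (by simp; omega)]
    rw [h]
    refine hfac ((W m).take (n + m).toNat) _ (((W m).drop (n + m).toNat).drop k) ?_
    rw [List.append_assoc, List.take_append_drop, List.take_append_drop]
    exact hP m
  · apply List.ext_getElem?
    intro i
    by_cases hi : i < w.length
    · have h := hx 0 i (by omega)
      rw [show W 0 = w from rfl] at h
      rw [h, List.getElem?_eq_getElem (by simpa [factor] using hi)]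
      simp [factor]
    · rw [List.getElem?_eq_none (by simp [factor]; omega), List.getElem?_eq_none (by omega)]

end SubshiftWords

/-! ### The language of a topological Markov Dyck shift -/

namespace MarkovDyck

open SubshiftWords CuntzKrieger

variable {N : ℕ} (A : Matrix (Fin N) (Fin N) ℤ)

/-- The value `φ_A(γ_1) ⋯ φ_A(γ_n)` in `𝓞_A` of a word `γ_1 ⋯ γ_n`. -/
noncomputable def wordValue (w : List (Symbol N)) : CuntzKrieger.algebra A := (w.map (phi A)).prod

/-- The element `t_{μ_1} ⋯ t_{μ_l}` of `𝓞_A`, the value of `β_{μ_1} ⋯ β_{μ_l}`. -/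
noncomputable def pathValue (μ : List (Fin N)) : CuntzKrieger.algebra A :=
  (μ.map (gen A)).prod

lemma wordValue_append (u v : List (Symbol N)) :
    wordValue A (u ++ v) = wordValue A u * wordValue A v := by
  simp [wordValue]

lemma wordValue_cons (a : Symbol N) (v : List (Symbol N)) :
    wordValue A (a :: v) = phi A a * wordValue A v := by
  simp [wordValue]

lemma pathValue_append (u v : List (Fin N)) :
    pathValue A (u ++ v) = pathValue A u * pathValue A v := by
  simp [pathValue]

lemma pathValue_cons (j : Fin N) (v : List (Fin N)) :
    pathValue A (j :: v) = gen A j * pathValue A v := by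
  simp [pathValue]

lemma wordValue_map_beta (μ : List (Fin N)) : wordValue A (μ.map beta) = pathValue A μ := by
  simp [wordValue, pathValue, Function.comp_def, phi]

/-- The word obtained by reversing and exchanging `α_i` with `β_i` has the adjoint value. -/
lemma wordValue_reverse_map_swap (w : List (Symbol N)) :
    wordValue A (w.map Sum.swap).reverse = star (wordValue A w) := by
  induction w with
  | nil => simp [wordValue]
  | cons a w ih =>
    rw [List.map_cons, List.reverse_cons, wordValue_append, ih, wordValue_cons,
      wordValue_cons, star_mul]
    cases a <;> simp [wordValue, phi]

/-- The admissible words of `D_A` are the words with nonzero value: since `∑ t_j t_j⋆ = 1`, a word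
with nonzero value can be continued by some `α_j` on the left and some `β_k` on the right. -/
lemma mem_language_iff {w : List (Symbol N)} :
    w ∈ language (dyckShift A) ↔ wordValue A w ≠ 0 := by
  constructor
  · rintro ⟨x, hx, n, hn⟩
    have := hx n w.length
    rwa [hn] at this
  · intro hw
    obtain ⟨x, hx, h⟩ := exists_sequence_of_extendable (P := fun w => wordValue A w ≠ 0)
      (fun u v w h => by
        rw [wordValue_append, wordValue_append] at h
        exact right_ne_zero_of_mul (left_ne_zero_of_mul h))
      (fun w h => by
        obtain ⟨j, hj⟩ := (gen_isFamily A).exists_star_mul_ne_zero h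
        obtain ⟨k, hk⟩ := (gen_isFamily A).exists_mul_ne_zero hj
        exact ⟨alpha j, beta k, by
          rw [wordValue_cons, wordValue_append, ← mul_assoc]
          simpa [wordValue, phi] using hk⟩) hw
    exact ⟨x, fun n k => hx n k, 0, h⟩

lemma mem_plusWords_iff {l : ℕ} {μ : List (Fin N)} :
    μ ∈ plusWords A l ↔ pathValue A μ ≠ 0 ∧ μ.length = l := by
  rw [← wordValue_map_beta, ← mem_language_iff]
  simp [plusWords, wordsOfLength]

lemma mem_predecessors_iff_wordValue {l : ℕ} {μ ν : List (Symbol N)} :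
    ν ∈ predecessors (dyckShift A) l μ ↔
      ν.length = l ∧ wordValue A ν * wordValue A μ ≠ 0 := by
  rw [mem_predecessors_iff, mem_language_iff, wordValue_append]

/-- Whether a word is `l`-synchronizing, and its `l`-past, depend only on its value. -/
lemma predecessors_congr {μ ν : List (Symbol N)} (h : wordValue A μ = wordValue A ν) (l : ℕ) :
    predecessors (dyckShift A) l μ = predecessors (dyckShift A) l ν := by
  ext
  rw [mem_predecessors_iff_wordValue, mem_predecessors_iff_wordValue, h]

lemma mem_syncWords_congr {μ ν : List (Symbol N)} (h : wordValue A μ = wordValue A ν) {l : ℕ}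
    (hμ : μ ∈ syncWords (dyckShift A) l) : ν ∈ syncWords (dyckShift A) l := by
  refine ⟨?_, fun ω hω => ?_⟩
  · rw [mem_language_iff, ← h, ← mem_language_iff]
    exact hμ.1
  · have h' : wordValue A (μ ++ ω) = wordValue A (ν ++ ω) := by
      rw [wordValue_append, wordValue_append, h]
    rw [← predecessors_congr A h, ← predecessors_congr A h']
    refine hμ.2 ω ⟨hω.1, ?_⟩
    rw [mem_language_iff, h', ← mem_language_iff]
    exact hω.2

end MarkovDyck

/-! ### Reduction of words against paths -/

namespace MarkovDyck

open SubshiftWords CuntzKrieger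

variable {N : ℕ} {A : Matrix (Fin N) (Fin N) ℤ}

lemma pathValue_take_ne_zero {μ : List (Fin N)} (h : pathValue A μ ≠ 0) (l : ℕ) :
    pathValue A (μ.take l) ≠ 0 := by
  rw [← List.take_append_drop l μ, pathValue_append] at h
  exact left_ne_zero_of_mul h

lemma wordValue_ne_zero_of_infix {u v w : List (Symbol N)} (h : wordValue A (u ++ v ++ w) ≠ 0) :
    wordValue A v ≠ 0 := by
  rw [wordValue_append, wordValue_append] at h
  exact right_ne_zero_of_mul (left_ne_zero_of_mul h)

/-- The action of a letter on a path that it does not annihilate is undone by its adjoint. The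
path has to be nonempty, as neither `t_j⋆ t_j` nor `t_j t_j⋆` need be `1`. -/
lemma star_phi_mul_cancel (hA : ∀ i j, A i j = 0 ∨ A i j = 1) {a : Symbol N} {ξ : List (Fin N)}
    (hξ : ξ ≠ []) (h : phi A a * pathValue A ξ ≠ 0) :
    star (phi A a) * (phi A a * pathValue A ξ) = pathValue A ξ := by
  have F := gen_isFamily A
  obtain ⟨k, ξ, rfl⟩ := List.exists_cons_of_ne_nil hξ
  rw [pathValue_cons] at h ⊢
  rcases a with j | j
  · simp only [phi, star_star] at h ⊢
    obtain rfl : j = k := by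
      by_contra hne
      rw [← mul_assoc, F.star_mul_eq_zero hne, zero_mul] at h
      exact h rfl
    rw [← mul_assoc, ← mul_assoc, F.partialIsometry]
  · exact F.star_mul_mul_cancel ((hA j k).resolve_left (F.entry_ne_zero h)) _

lemma star_gen_mul_pathValue (hA : ∀ i j, A i j = 0 ∨ A i j = 1) {j : Fin N} {ξ : List (Fin N)}
    (hξ : ξ ≠ []) (h : pathValue A (j :: ξ) ≠ 0) :
    star (gen A j) * pathValue A (j :: ξ) = pathValue A ξ := by
  rw [pathValue_cons] at h ⊢
  exact star_phi_mul_cancel hA (a := beta j) hξ h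

/-- A letter that does not annihilate a path of length at least two prepends a letter to it or
removes its first letter. -/
lemma phi_mul_pathValue (hA : ∀ i j, A i j = 0 ∨ A i j = 1) {a : Symbol N} {ξ : List (Fin N)}
    (hξ : 2 ≤ ξ.length) (h : phi A a * pathValue A ξ ≠ 0) :
    (∃ j, a = beta j ∧ phi A a * pathValue A ξ = pathValue A (j :: ξ)) ∨
      ∃ j ρ, a = alpha j ∧ ξ = j :: ρ ∧ phi A a * pathValue A ξ = pathValue A ρ := by
  rcases a with j | j
  · right
    match ξ, hξ with
    | k :: m :: ρ, _ =>
      obtain rfl : j = k := by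
        by_contra hne
        rw [pathValue_cons, ← mul_assoc, phi, (gen_isFamily A).star_mul_eq_zero hne, zero_mul] at h
        exact h rfl
      exact ⟨j, m :: ρ, rfl, rfl,
        star_gen_mul_pathValue hA (by simp) (right_ne_zero_of_mul h)⟩
  · exact Or.inl ⟨j, rfl, (pathValue_cons A j ξ).symm⟩

/-- A word that does not annihilate a longer path carries it to a path. -/
lemma exists_wordValue_mul_pathValue (hA : ∀ i j, A i j = 0 ∨ A i j = 1) {w : List (Symbol N)}
    {η : List (Fin N)} (hlen : w.length < η.length)
    (h : wordValue A w * pathValue A η ≠ 0) :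
    ∃ ξ, wordValue A w * pathValue A η = pathValue A ξ ∧ η.length ≤ ξ.length + w.length := by
  induction w with
  | nil => exact ⟨η, by simp [wordValue], by simp⟩
  | cons a w ih =>
    rw [wordValue_cons, mul_assoc] at h ⊢
    rw [List.length_cons] at hlen
    obtain ⟨ξ, h1, h2⟩ := ih (by omega) (right_ne_zero_of_mul h)
    rw [h1] at h ⊢
    rcases phi_mul_pathValue hA (by omega) h with ⟨j, -, h3⟩ | ⟨j, ρ, -, rfl, h3⟩
    · exact ⟨_, h3, by simp; omega⟩
    · exact ⟨_, h3, by simp at h2 ⊢; omega⟩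

/-- A word that does not annihilate a path of at least the same length can be undone by
another left multiplication. -/
lemma exists_mul_wordValue_mul_pathValue (hA : ∀ i j, A i j = 0 ∨ A i j = 1)
    {w : List (Symbol N)} {η : List (Fin N)} (hlen : w.length ≤ η.length)
    (h : wordValue A w * pathValue A η ≠ 0) :
    ∃ c, c * (wordValue A w * pathValue A η) = pathValue A η := by
  induction w with
  | nil => exact ⟨1, by simp [wordValue]⟩
  | cons a w ih =>
    rw [wordValue_cons, mul_assoc] at h ⊢
    rw [List.length_cons] at hlen
    have h' := right_ne_zero_of_mul h
    obtain ⟨c, hc⟩ := ih (by omega) h'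
    obtain ⟨ξ, h1, h2⟩ := exists_wordValue_mul_pathValue hA (by omega) h'
    refine ⟨c * star (phi A a), ?_⟩
    rw [h1] at h hc ⊢
    rw [mul_assoc, star_phi_mul_cancel hA (List.ne_nil_of_length_pos (by omega)) h, hc]

/-- Every word with nonzero value continues to a word whose value is that of a long path. -/
lemma exists_append_beta (hA : ∀ i j, A i j = 0 ∨ A i j = 1) {w : List (Symbol N)}
    (hw : wordValue A w ≠ 0) (n : ℕ) :
    ∃ η ξ : List (Fin N), η.length = w.length + n + 1 ∧
      wordValue A (w ++ η.map beta) = pathValue A ξ ∧ pathValue A ξ ≠ 0 ∧ n < ξ.length := by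
  obtain ⟨η, h1, h2⟩ := (gen_isFamily A).exists_mul_prod_ne_zero hw (w.length + n + 1)
  obtain ⟨ξ, h3, h4⟩ := exists_wordValue_mul_pathValue hA (by omega) h2
  refine ⟨η, ξ, h1, ?_, ?_, by omega⟩
  · rw [wordValue_append, wordValue_map_beta, h3]
  · rw [← h3]
    exact h2

/-! ### Synchronizing words -/

lemma map_beta_mem_syncWords (hA : ∀ i j, A i j = 0 ∨ A i j = 1) {l : ℕ} {μ : List (Fin N)}
    (h : pathValue A μ ≠ 0) (hl : l ≤ μ.length) :
    μ.map beta ∈ syncWords (dyckShift A) l := by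
  refine ⟨by rwa [mem_language_iff, wordValue_map_beta], fun ω hω => ?_⟩
  ext ν
  rw [mem_predecessors_iff_wordValue, mem_predecessors_iff_wordValue, wordValue_append,
    wordValue_map_beta, ← mul_assoc]
  have hω' := hω.2
  rw [mem_language_iff, wordValue_append, wordValue_map_beta] at hω'
  refine and_congr_right fun hν => ⟨fun h1 h2 => ?_, left_ne_zero_of_mul⟩
  obtain ⟨c, hc⟩ := exists_mul_wordValue_mul_pathValue hA (by omega) h1
  rw [← hc, mul_assoc, h2, mul_zero] at hω'
  exact hω' rfl

lemma mem_syncWords_of_wordValue (hA : ∀ i j, A i j = 0 ∨ A i j = 1) {l : ℕ}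
    {w : List (Symbol N)} {ξ : List (Fin N)} (hw : wordValue A w = pathValue A ξ)
    (h : pathValue A ξ ≠ 0) (hl : l ≤ ξ.length) : w ∈ syncWords (dyckShift A) l :=
  mem_syncWords_congr A ((wordValue_map_beta A ξ).trans hw.symm) (map_beta_mem_syncWords hA h hl)

/-- The `l`-past of a word whose value is that of a path is the `l`-past of the first `l` letters of
the path. -/
lemma predecessors_of_wordValue (hA : ∀ i j, A i j = 0 ∨ A i j = 1) {l : ℕ}
    {w : List (Symbol N)} {ξ : List (Fin N)} (hw : wordValue A w = pathValue A ξ)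
    (h : pathValue A ξ ≠ 0) (hl : l ≤ ξ.length) :
    predecessors (dyckShift A) l w = predecessors (dyckShift A) l ((ξ.take l).map beta) := by
  have hs := map_beta_mem_syncWords hA (pathValue_take_ne_zero h l) (l := l) (by simp [hl])
  have hval : wordValue A w = wordValue A ((ξ.take l).map beta ++ (ξ.drop l).map beta) := by
    rw [← List.map_append, List.take_append_drop, wordValue_map_beta, hw]
  have hlang : (ξ.take l).map beta ++ (ξ.drop l).map beta ∈ language (dyckShift A) := by
    rw [mem_language_iff, ← hval, hw]
    exact h
  rw [hs.2 _ ⟨mem_language_of_append_right hlang, hlang⟩]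
  exact predecessors_congr A hval l

/-- The `l`-past of `β_{μ_1} ⋯ β_{μ_l}` determines `μ`, because it contains
`α_{ν_l} ⋯ α_{ν_1}` only for `ν = μ`. -/
lemma eq_of_predecessors_eq {l : ℕ} {μ ν : List (Fin N)} (hμ : μ ∈ plusWords A l)
    (hν : ν ∈ plusWords A l) (h : predecessors (dyckShift A) l (μ.map beta) =
      predecessors (dyckShift A) l (ν.map beta)) : μ = ν := by
  rw [mem_plusWords_iff] at hμ hν
  have hval : wordValue A ((μ.map beta).map Sum.swap).reverse = star (pathValue A μ) := by
    rw [wordValue_reverse_map_swap, wordValue_map_beta]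
  have h1 : ((μ.map beta).map Sum.swap).reverse ∈
      predecessors (dyckShift A) l (μ.map beta) := by
    rw [mem_predecessors_iff_wordValue, hval, wordValue_map_beta]
    exact ⟨by simp [hμ.2], fun h0 => hμ.1 ((CStarRing.star_mul_self_eq_zero_iff _).1 h0)⟩
  rw [h, mem_predecessors_iff_wordValue, hval, wordValue_map_beta] at h1
  have key : ∀ {μ ν : List (Fin N)}, μ.length = ν.length →
      star (pathValue A μ) * pathValue A ν ≠ 0 → μ = ν := by
    intro μ
    induction μ with
    | nil => intro ν hlen _; exact (List.length_eq_zero_iff.1 hlen.symm).symm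
    | cons i μ ih =>
      intro ν hlen hne
      obtain _ | ⟨j, ν⟩ := ν
      · simp at hlen
      rw [pathValue_cons, pathValue_cons, star_mul, mul_assoc] at hne
      obtain rfl : i = j := by
        by_contra hij
        rw [← mul_assoc (star (gen A i)), (gen_isFamily A).star_mul_eq_zero hij] at hne
        simp at hne
      -- The middle factor `t_i⋆ t_i` acts on `t_ν` as an entry of `A`, unless `ν` is empty.
      congr 1
      obtain _ | ⟨k, ρ⟩ := ν
      · exact List.length_eq_zero_iff.1 (by simpa using hlen)
      refine ih (by simpa using hlen) fun h0 => hne ?_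
      rw [pathValue_cons, ← mul_assoc (star (gen A i)), ← mul_assoc (star (gen A i) * gen A i),
        (gen_isFamily A).source_mul, smul_mul_assoc, mul_smul_comm, ← pathValue_cons, h0, smul_zero]
  exact key (hμ.2.trans hν.2.symm) h1.2

lemma lambdaSyncCondition_dyckShift (hA : ∀ i j, A i j = 0 ∨ A i j = 1) :
    LambdaSyncCondition (dyckShift A) := by
  intro l k hlk η hη
  obtain ⟨ν, ξ, h1, h2, h3, h4⟩ := exists_append_beta hA ((mem_language_iff A).1 hη.1) k
  refine ⟨ν.map beta, map_beta_mem_syncWords hA ?_ (by omega),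
    mem_syncWords_of_wordValue hA h2 h3 (by omega)⟩
  rw [← h2, wordValue_append, wordValue_map_beta] at h3
  exact right_ne_zero_of_mul h3

/-! ### Irreducibility -/

/-- For paths `x` and `y` that end in the same letter, `t_x t_y⋆` is nonzero. -/
lemma pathValue_mul_star_ne_zero (hA : ∀ i j, A i j = 0 ∨ A i j = 1) {x y : List (Fin N)}
    {j : Fin N} (hx : pathValue A (x ++ [j]) ≠ 0) (hy : pathValue A (y ++ [j]) ≠ 0) :
    pathValue A (x ++ [j]) * star (pathValue A (y ++ [j])) ≠ 0 := by
  have F := gen_isFamily A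
  have h1 : star (pathValue A (x ++ [j])) * pathValue A (x ++ [j]) = star (gen A j) * gen A j :=
    F.star_prod_mul_prod hA hx
  have h2 : star (pathValue A (y ++ [j])) * pathValue A (y ++ [j]) = star (gen A j) * gen A j :=
    F.star_prod_mul_prod hA hy
  intro h0
  have h3 : star (gen A j) * gen A j * (star (gen A j) * gen A j) = 0 := by
    conv_lhs =>
      enter [1]
      rw [← h1]
    rw [← h2, mul_assoc, ← mul_assoc (pathValue A (x ++ [j])), h0, zero_mul, mul_zero]
  rw [mul_assoc, ← mul_assoc _ (star _), F.partialIsometry,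
    CStarRing.star_mul_self_eq_zero_iff] at h3
  rw [pathValue_append] at hx
  simp [pathValue, h3] at hx

lemma isIrreducibleSubshift_dyckShift (hA : ∀ i j, A i j = 0 ∨ A i j = 1)
    (hirr : A.IsIrreducible) : IsIrreducibleSubshift (dyckShift A) := by
  intro μ hμ ν hν
  rw [mem_language_iff] at hμ hν
  -- Words on the right turn `μ` into a path, words on the left turn `ν` into the adjoint of a path.
  obtain ⟨η, ξ, -, h1, h2, h3⟩ := exists_append_beta hA hμ 0
  have hν' : wordValue A (ν.map Sum.swap).reverse ≠ 0 := by
    rw [wordValue_reverse_map_swap]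
    exact star_ne_zero.2 hν
  obtain ⟨θ, ζ, -, h4, h5, h6⟩ := exists_append_beta hA hν' 0
  obtain ⟨ξ, i, rfl⟩ := (List.eq_nil_or_concat ξ).resolve_left (List.ne_nil_of_length_pos h3)
  obtain ⟨ζ, j, rfl⟩ := (List.eq_nil_or_concat ζ).resolve_left (List.ne_nil_of_length_pos h6)
  rw [List.concat_eq_append] at h1 h2 h4 h5
  obtain ⟨ρ, hρ⟩ := (gen_isFamily A).exists_connecting_path hA hirr h2 j
  have h7 := pathValue_mul_star_ne_zero hA hρ h5
  have h8 : wordValue A (((θ.map beta).map Sum.swap).reverse ++ ν) =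
      star (pathValue A (ζ ++ [j])) := by
    rw [← h4, wordValue_append, wordValue_append, wordValue_reverse_map_swap,
      wordValue_reverse_map_swap, star_mul, star_star]
  have h9 : wordValue A (μ ++ (η.map beta ++ (ρ ++ [j]).map beta ++
      ((θ.map beta).map Sum.swap).reverse) ++ ν) ≠ 0 := by
    rw [← h8, List.append_assoc _ ρ, pathValue_append, ← h1, ← wordValue_map_beta,
      ← wordValue_append, ← wordValue_append] at h7
    simpa only [List.append_assoc] using h7
  refine ⟨_, (mem_language_iff A).2 (wordValue_ne_zero_of_infix h9), ?_⟩
  exact (mem_language_iff A).2 h9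

end MarkovDyck

/-! ### Left-resolving diagrams and isomorphisms -/

namespace LabeledBratteli

variable {S : Type*}

/-- In a left-resolving diagram the local property holds as soon as edges into `v` and into `ι v`
carry the same labels and edges with equal labels have sources that correspond under `ι`. -/
lemma local_property_of_src {G : LabeledBratteli S}
    (hlr : ∀ l (e f : G.E l), G.label e = G.label f → G.tgt e = G.tgt f → e = f)
    (hinc : ∀ l (v : G.V (l + 2)) (a : S), (∃ e : G.E (l + 1), G.label e = a ∧ G.tgt e = v) ↔
      ∃ e : G.E l, G.label e = a ∧ G.tgt e = G.iota v)
    (hsrc : ∀ l (e : G.E (l + 1)) (f : G.E l), G.label f = G.label e →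
      G.tgt f = G.iota (G.tgt e) → G.src f = G.iota (G.src e))
    (l : ℕ) (u : G.V l) (v : G.V (l + 2)) :
    ∃ f : {e : G.E (l + 1) // G.tgt e = v ∧ G.iota (G.src e) = u} ≃
        {e : G.E l // G.src e = u ∧ G.tgt e = G.iota v},
      ∀ e, G.label (f e).1 = G.label e.1 := by
  have hex : ∀ e : {e : G.E (l + 1) // G.tgt e = v ∧ G.iota (G.src e) = u},
      ∃ f : {e : G.E l // G.src e = u ∧ G.tgt e = G.iota v}, G.label f.1 = G.label e.1 := by
    rintro ⟨e, rfl, rfl⟩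
    obtain ⟨f, h1, h2⟩ := (hinc l (G.tgt e) (G.label e)).1 ⟨e, rfl, rfl⟩
    exact ⟨⟨f, hsrc l e f h1 h2, h2⟩, h1⟩
  choose F hF using hex
  refine ⟨Equiv.ofBijective F ⟨fun e e' h => ?_, fun f => ?_⟩, hF⟩
  · exact Subtype.ext (hlr _ _ _ (by rw [← hF, ← hF, h]) (e.2.1.trans e'.2.1.symm))
  · obtain ⟨f, hf1, hf2⟩ := f
    obtain ⟨e, h1, h2⟩ := (hinc l v (G.label f)).2 ⟨f, rfl, hf2⟩
    subst h2
    refine ⟨⟨e, rfl, (hsrc l e f h1.symm hf2).symm.trans hf1⟩, ?_⟩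
    exact Subtype.ext (hlr _ _ _ ((hF _).trans h1) ((F _).2.2.trans hf2.symm))

/-- Isomorphisms preserve the axioms of a `λ`-graph system. -/
lemma IsLambdaGraphSystem.of_iso {G H : LabeledBratteli S} (hG : G.IsLambdaGraphSystem)
    (Φ : G.Iso H) : H.IsLambdaGraphSystem where
  finite_V l := have := hG.finite_V l; Finite.of_equiv _ (Φ.onV l)
  finite_E l := have := hG.finite_E l; Finite.of_equiv _ (Φ.onE l)
  iota_surjective l v := by
    obtain ⟨w, hw⟩ := hG.iota_surjective l ((Φ.onV l).symm v)
    exact ⟨Φ.onV _ w, by rw [Φ.iota_comm, hw, Equiv.apply_symm_apply]⟩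
  exists_successor l v := by
    obtain ⟨e, he⟩ := hG.exists_successor l ((Φ.onV l).symm v)
    exact ⟨Φ.onE l e, by rw [Φ.src_comm, he, Equiv.apply_symm_apply]⟩
  exists_predecessor l v := by
    obtain ⟨e, he⟩ := hG.exists_predecessor l ((Φ.onV (l + 1)).symm v)
    exact ⟨Φ.onE l e, by rw [Φ.tgt_comm, he, Equiv.apply_symm_apply]⟩
  incoming_label_iff l v a := by
    obtain ⟨v, rfl⟩ := (Φ.onV (l + 2)).surjective v
    simpa only [(Φ.onE _).surjective.exists, Φ.label_comm, Φ.tgt_comm, Φ.iota_comm,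
      EmbeddingLike.apply_eq_iff_eq] using hG.incoming_label_iff l v a
  local_property l u v := by
    obtain ⟨v, rfl⟩ := (Φ.onV (l + 2)).surjective v
    obtain ⟨u, rfl⟩ := (Φ.onV l).surjective u
    obtain ⟨f, hf⟩ := hG.local_property l u v
    refine ⟨((Φ.onE (l + 1)).subtypeEquiv fun e => ?_).symm.trans
      (f.trans ((Φ.onE l).subtypeEquiv fun e => ?_)), fun e => ?_⟩
    · simp only [Φ.tgt_comm, Φ.src_comm, Φ.iota_comm, EmbeddingLike.apply_eq_iff_eq]
    · simp only [Φ.tgt_comm, Φ.src_comm, Φ.iota_comm, EmbeddingLike.apply_eq_iff_eq]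
    · simp only [Equiv.trans_apply, Equiv.subtypeEquiv_apply, Φ.label_comm, hf]
      rw [← Φ.label_comm]
      simp
  left_resolving l e f h1 h2 := by
    obtain ⟨e, rfl⟩ := (Φ.onE l).surjective e
    obtain ⟨f, rfl⟩ := (Φ.onE l).surjective f
    rw [Φ.label_comm, Φ.label_comm] at h1
    rw [Φ.tgt_comm, Φ.tgt_comm, EmbeddingLike.apply_eq_iff_eq] at h2
    rw [hG.left_resolving l e f h1 h2]

end LabeledBratteli

/-! ### The Cantor horizon system -/

namespace MarkovDyck

open SubshiftWords CuntzKrieger LabeledBratteli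

variable {N : ℕ} {A : Matrix (Fin N) (Fin N) ℤ}

lemma exists_append_mem_plusWords {l : ℕ} {μ : List (Fin N)} (h : μ ∈ plusWords A l) (n : ℕ) :
    ∃ ρ : List (Fin N), ρ.length = n ∧ μ ++ ρ ∈ plusWords A (l + n) := by
  rw [mem_plusWords_iff] at h
  obtain ⟨ρ, h1, h2⟩ := (gen_isFamily A).exists_mul_prod_ne_zero h.1 n
  refine ⟨ρ, h1, ?_⟩
  rw [mem_plusWords_iff, pathValue_append]
  exact ⟨h2, by simp [h.2, h1]⟩

lemma tail_mem_plusWords {l : ℕ} {j : Fin N} {μ : List (Fin N)}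
    (h : j :: μ ∈ plusWords A (l + 1)) : μ ∈ plusWords A l := by
  rw [mem_plusWords_iff, pathValue_cons] at h
  rw [mem_plusWords_iff]
  exact ⟨right_ne_zero_of_mul h.1, by simpa using h.2⟩

/-- Whether a letter can precede a path is decided by the first letter of the path. -/
lemma cons_mem_plusWords (hA : ∀ i j, A i j = 0 ∨ A i j = 1) {j : Fin N} {l m : ℕ}
    {μ : List (Fin N)} (h : j :: μ.take (m + 1) ∈ plusWords A l) (hμ : pathValue A μ ≠ 0) :
    pathValue A (j :: μ) ≠ 0 := by
  rw [mem_plusWords_iff] at h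
  obtain _ | ⟨k, μ⟩ := μ
  · simpa using h.1
  · exact (gen_isFamily A).prod_cons_ne_zero hA h.1 hμ

/-- Label and target of an edge of the Cantor horizon system determine its source. -/
lemma cantorHorizon_src_val {l : ℕ} (e : (cantorHorizon A).E l) :
    e.1.1.1 = Sum.elim (fun _ => e.1.2.2.1.tail) (fun j => (j :: e.1.2.2.1).take l) e.1.2.1 := by
  rcases e.2 with ⟨j, ha, hv⟩ | ⟨j, ha, -, hu⟩
  · rw [ha, hv]
    rfl
  · rw [ha]
    exact hu

lemma cantorHorizon_exists_edge_iff {l : ℕ} (v : plusWords A (l + 1)) (a : Symbol N) :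
    (∃ e : (cantorHorizon A).E l, e.1.2.1 = a ∧ e.1.2.2 = v) ↔
      (∃ j μ, a = alpha j ∧ v.1 = j :: μ) ∨ ∃ j, a = beta j ∧ j :: v.1 ∈ plusWords A (l + 2) := by
  constructor
  · rintro ⟨e, rfl, rfl⟩
    rcases e.2 with ⟨j, ha, hv⟩ | ⟨j, ha, hv, -⟩
    · exact Or.inl ⟨j, _, ha, hv⟩
    · exact Or.inr ⟨j, ha, hv⟩
  · rintro (⟨j, μ, rfl, hv⟩ | ⟨j, rfl, hv⟩)
    · have hμ : μ ∈ plusWords A l := tail_mem_plusWords (hv ▸ v.2)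
      exact ⟨⟨⟨⟨μ, hμ⟩, alpha j, v⟩, Or.inl ⟨j, rfl, hv⟩⟩, rfl, rfl⟩
    · exact ⟨⟨⟨⟨_, take_mem_plusWords (Nat.le_add_right l 2) hv⟩, beta j, v⟩,
        Or.inr ⟨j, rfl, hv, rfl⟩⟩, rfl, rfl⟩

lemma isLambdaGraphSystem_cantorHorizon (hA : ∀ i j, A i j = 0 ∨ A i j = 1) :
    (cantorHorizon A).IsLambdaGraphSystem := by
  have hfin : ∀ l, Finite (plusWords A l) := fun l =>
    ((List.finite_length_eq (Fin N) l).subset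
      fun μ hμ => ((mem_plusWords_iff A).1 hμ).2).to_subtype
  have hlr : ∀ l (e f : (cantorHorizon A).E l), (cantorHorizon A).label e =
      (cantorHorizon A).label f → (cantorHorizon A).tgt e = (cantorHorizon A).tgt f → e = f := by
    intro l e f (h1 : e.1.2.1 = f.1.2.1) (h2 : e.1.2.2 = f.1.2.2)
    refine Subtype.ext (Prod.ext (Subtype.ext ?_) (Prod.ext h1 h2))
    rw [cantorHorizon_src_val, cantorHorizon_src_val, h1, h2]
  have hinc : ∀ l (v : (cantorHorizon A).V (l + 2)) (a : Symbol N),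
      (∃ e : (cantorHorizon A).E (l + 1), (cantorHorizon A).label e = a ∧
        (cantorHorizon A).tgt e = v) ↔
      ∃ e : (cantorHorizon A).E l, (cantorHorizon A).label e = a ∧
        (cantorHorizon A).tgt e = (cantorHorizon A).iota v := by
    intro l v a
    have hv := (mem_plusWords_iff A).1 v.2
    refine (cantorHorizon_exists_edge_iff v a).trans
      (Iff.trans ?_ (cantorHorizon_exists_edge_iff ((cantorHorizon A).iota v) a).symm)
    change _ ↔ (∃ j μ, a = alpha j ∧ v.1.take (l + 1) = j :: μ) ∨
      ∃ j, a = beta j ∧ j :: v.1.take (l + 1) ∈ plusWords A (l + 2)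
    refine or_congr (exists_congr fun j => ?_) (exists_congr fun j => and_congr_right fun _ => ?_)
    · obtain ⟨k, ρ, hk⟩ := List.exists_cons_of_length_pos (l := v.1) (by omega)
      simp [hk]
    · refine ⟨fun h => by simpa using take_mem_plusWords (Nat.le_succ (l + 2)) h, fun h => ?_⟩
      rw [mem_plusWords_iff]
      exact ⟨cons_mem_plusWords hA h hv.1, by simp [hv.2]⟩
  have hsrc : ∀ l (e : (cantorHorizon A).E (l + 1)) (f : (cantorHorizon A).E l),
      (cantorHorizon A).label f = (cantorHorizon A).label e →
      (cantorHorizon A).tgt f = (cantorHorizon A).iota ((cantorHorizon A).tgt e) →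
      (cantorHorizon A).src f = (cantorHorizon A).iota ((cantorHorizon A).src e) := by
    intro l e f (h1 : f.1.2.1 = e.1.2.1) h2
    have h3 : f.1.2.2.1 = e.1.2.2.1.take (l + 1) := congrArg Subtype.val h2
    apply Subtype.ext
    change f.1.1.1 = e.1.1.1.take l
    rw [cantorHorizon_src_val, cantorHorizon_src_val, h1, h3]
    rcases e.1.2.1 with j | j
    · cases e.1.2.2.1 <;> simp
    · rw [Sum.elim_inr, Sum.elim_inr, ← List.take_succ_cons, List.take_take, List.take_take]
      congr 1
      omega
  exact
  { finite_V := hfin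
    finite_E := fun l => by
      have := hfin l
      have := hfin (l + 1)
      exact Subtype.finite
    iota_surjective := fun l v => by
      obtain ⟨ρ, h1, h2⟩ := exists_append_mem_plusWords v.2 1
      refine ⟨⟨_, h2⟩, Subtype.ext ?_⟩
      change (v.1 ++ ρ).take l = v.1
      exact List.take_left' ((mem_plusWords_iff A).1 v.2).2
    exists_successor := fun l v => by
      -- The vertex `v` extends to an admissible path `j :: ρ` of length `l + 2`.
      obtain ⟨ρ, h1, h2⟩ := exists_append_mem_plusWords v.2 2
      have hv := ((mem_plusWords_iff A).1 v.2).2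
      obtain ⟨j, σ, hσ⟩ := List.exists_cons_of_length_pos (l := v.1 ++ ρ) (by simp [h1])
      rw [hσ] at h2
      refine ⟨⟨⟨v, beta j, ⟨σ, tail_mem_plusWords h2⟩⟩, Or.inr ⟨j, rfl, h2, ?_⟩⟩, rfl⟩
      change v.1 = (j :: σ).take l
      rw [← hσ, List.take_left' hv]
    exists_predecessor := fun l v => by
      obtain ⟨v, hv⟩ := v
      obtain ⟨j, ρ, rfl⟩ := List.exists_cons_of_length_pos (l := v)
        (by rw [((mem_plusWords_iff A).1 hv).2]; omega)
      exact ⟨⟨⟨⟨ρ, tail_mem_plusWords hv⟩, alpha j, ⟨_, hv⟩⟩, Or.inl ⟨j, rfl, rfl⟩⟩, rfl⟩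
    incoming_label_iff := hinc
    local_property := local_property_of_src hlr hinc hsrc
    left_resolving := hlr }

lemma take_mem_plusWords_of_ne_zero {l : ℕ} {ξ : List (Fin N)} (h : pathValue A ξ ≠ 0)
    (hl : l ≤ ξ.length) : ξ.take l ∈ plusWords A l := by
  rw [mem_plusWords_iff]
  exact ⟨pathValue_take_ne_zero h _, by simp [hl]⟩

/-- If `w` carries the path `κ` to the path `ξ`, then the prefixes of the intermediate values are
the vertices of a path of the Cantor horizon system with label `w`. -/
lemma leaves_of_wordValue_mul (hA : ∀ i j, A i j = 0 ∨ A i j = 1) {w : List (Symbol N)}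
    {κ : List (Fin N)} (h : wordValue A w * pathValue A κ ≠ 0) (hlen : w.length < κ.length) :
    ∃ ξ, wordValue A w * pathValue A κ = pathValue A ξ ∧ κ.length ≤ ξ.length + w.length ∧
      ∀ l, w.length + l < κ.length → ∀ v : (cantorHorizon A).V l, v.1 = ξ.take l →
        (cantorHorizon A).Leaves w v := by
  induction w with
  | nil => exact ⟨κ, by simp [wordValue], by simp, fun _ _ _ _ => trivial⟩
  | cons a w ih =>
    rw [List.length_cons] at hlen
    rw [wordValue_cons, mul_assoc] at h ⊢
    obtain ⟨ζ, h1, h2, h3⟩ := ih (right_ne_zero_of_mul h) (by omega)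
    rw [h1] at h ⊢
    have hζ := right_ne_zero_of_mul h
    have hmem : ∀ l, w.length + 1 + l < κ.length → ζ.take (l + 1) ∈ plusWords A (l + 1) :=
      fun l hl => take_mem_plusWords_of_ne_zero hζ (by omega)
    rcases phi_mul_pathValue hA (by omega) h with ⟨j, rfl, h4⟩ | ⟨j, ρ, rfl, rfl, h4⟩
    · refine ⟨j :: ζ, h4, by simp; omega, fun l hl v hv => ?_⟩
      rw [List.length_cons] at hl
      refine ⟨⟨⟨v, beta j, ⟨_, hmem l hl⟩⟩, Or.inr ⟨j, rfl, ?_, ?_⟩⟩, rfl, rfl,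
        h3 (l + 1) (by omega) _ rfl⟩
      · change j :: ζ.take (l + 1) ∈ _
        rw [← List.take_succ_cons]
        exact take_mem_plusWords_of_ne_zero (h4 ▸ h) (by simp; omega)
      · change v.1 = (j :: ζ.take (l + 1)).take l
        rw [hv, ← List.take_succ_cons, List.take_take]
        congr 1
        omega
    · refine ⟨ρ, h4, by simp at h2 ⊢; omega, fun l hl v hv => ?_⟩
      rw [List.length_cons] at hl
      refine ⟨⟨⟨v, alpha j, ⟨_, hmem l hl⟩⟩, Or.inl ⟨j, rfl, ?_⟩⟩, rfl, rfl,
        h3 (l + 1) (by omega) _ rfl⟩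
      change (j :: ρ).take (l + 1) = j :: v.1
      rw [hv, List.take_succ_cons]

/-- The label of a path of the Cantor horizon system that starts at `v_μ` carries some path to a
path that properly extends `μ`. -/
lemma exists_wordValue_mul_of_leaves (hA : ∀ i j, A i j = 0 ∨ A i j = 1) {w : List (Symbol N)}
    {l : ℕ} {v : (cantorHorizon A).V l} (h : (cantorHorizon A).Leaves w v) :
    ∃ κ ξ, wordValue A w * pathValue A κ = pathValue A ξ ∧ pathValue A ξ ≠ 0 ∧
      l < ξ.length ∧ ξ.take l = v.1 := by
  induction w generalizing l with
  | nil =>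
    obtain ⟨ρ, h1, h2⟩ := exists_append_mem_plusWords v.2 1
    have hv := ((mem_plusWords_iff A).1 v.2).2
    exact ⟨v.1 ++ ρ, v.1 ++ ρ, by simp [wordValue], ((mem_plusWords_iff A).1 h2).1, by simp [hv, h1],
      List.take_left' hv⟩
  | cons a w ih =>
    obtain ⟨e, rfl, rfl, hw⟩ := h
    obtain ⟨κ, ξ, h1, h2, h3, h4⟩ := ih hw
    change ξ.take (l + 1) = e.1.2.2.1 at h4
    rw [wordValue_cons]
    simp only [mul_assoc]
    change ∃ κ ρ, phi A e.1.2.1 * (wordValue A w * pathValue A κ) = _ ∧ _ ∧ _ ∧ _ = e.1.1.1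
    rcases e.2 with ⟨j, hj, hv⟩ | ⟨j, hj, hv, hu⟩
    · rw [hv] at h4
      obtain ⟨k, ρ, rfl⟩ := List.exists_cons_of_length_pos (l := ξ) (by omega)
      rw [List.take_succ_cons] at h4
      obtain ⟨rfl, h5⟩ := List.cons_eq_cons.1 h4
      rw [List.length_cons] at h3
      refine ⟨κ, ρ, ?_, ?_, by omega, h5⟩
      · rw [h1, hj]
        exact star_gen_mul_pathValue hA (List.ne_nil_of_length_pos (by omega)) h2
      · rw [pathValue_cons] at h2
        exact right_ne_zero_of_mul h2
    · rw [← h4] at hv hu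
      refine ⟨κ, j :: ξ, ?_, cons_mem_plusWords hA hv h2, by simp; omega, ?_⟩
      · rw [h1, hj, pathValue_cons]
        rfl
      · rw [hu, ← List.take_succ_cons, List.take_take]
        congr 1
        omega

lemma presents_cantorHorizon (hA : ∀ i j, A i j = 0 ∨ A i j = 1) :
    (cantorHorizon A).Presents (dyckShift A) := by
  intro w
  rw [mem_language_iff]
  constructor
  · intro hw
    obtain ⟨κ, h1, h2⟩ := (gen_isFamily A).exists_mul_prod_ne_zero hw (w.length + 1)
    obtain ⟨ξ, h3, h4, h5⟩ := leaves_of_wordValue_mul hA h2 (by omega)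
    have hξ : pathValue A ξ ≠ 0 := h3 ▸ h2
    exact ⟨0, ⟨_, take_mem_plusWords_of_ne_zero hξ (Nat.zero_le _)⟩, h5 0 (by omega) _ rfl⟩
  · rintro ⟨l, v, h⟩
    obtain ⟨κ, ξ, h1, h2, -⟩ := exists_wordValue_mul_of_leaves hA h
    rw [← h1] at h2
    exact left_ne_zero_of_mul h2

/-! ### The isomorphism -/

/-- The vertex map `v_μ ↦ [β_μ]_l`. -/
def vertexClass (hA : ∀ i j, A i j = 0 ∨ A i j = 1) (l : ℕ) (μ : plusWords A l) :
    SyncClass (dyckShift A) l :=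
  syncClass (dyckShift A) l (μ.1.map beta) (map_beta_mem_syncWords hA
    ((mem_plusWords_iff A).1 μ.2).1 ((mem_plusWords_iff A).1 μ.2).2.ge)

lemma syncClass_eq_iff {S : Type} [TopologicalSpace S]
    {L : SymbolicDynamics.FullShift.Subshift S ℤ} {l : ℕ} {μ ν : List S}
    {hμ : μ ∈ syncWords L l} {hν : ν ∈ syncWords L l} :
    syncClass L l μ hμ = syncClass L l ν hν ↔ predecessors L l μ = predecessors L l ν :=
  Quotient.eq (r := pastSetoid L l)

/-- The class of a word whose value is that of a path. -/
lemma vertexClass_eq_syncClass (hA : ∀ i j, A i j = 0 ∨ A i j = 1) {l : ℕ} {μ : plusWords A l}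
    {w : List (Symbol N)} {ξ : List (Fin N)} (hw : wordValue A w = pathValue A ξ)
    (h : pathValue A ξ ≠ 0) (hl : l ≤ ξ.length) (hμ : μ.1 = ξ.take l)
    (hs : w ∈ syncWords (dyckShift A) l) :
    vertexClass hA l μ = syncClass (dyckShift A) l w hs := by
  refine syncClass_eq_iff.2 ?_
  rw [hμ]
  exact (predecessors_of_wordValue hA hw h hl).symm

lemma vertexClass_bijective (hA : ∀ i j, A i j = 0 ∨ A i j = 1) (l : ℕ) :
    Function.Bijective (vertexClass hA l) := by
  refine ⟨fun μ ν h => Subtype.ext (eq_of_predecessors_eq μ.2 ν.2 (syncClass_eq_iff.1 h)), ?_⟩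
  rintro ⟨w, hw⟩
  obtain ⟨η, ξ, -, h1, h2, h3⟩ := exists_append_beta hA ((mem_language_iff A).1 hw.1) l
  refine ⟨⟨_, take_mem_plusWords_of_ne_zero h2 h3.le⟩, ?_⟩
  rw [vertexClass_eq_syncClass hA h1 h2 h3.le rfl (mem_syncWords_of_wordValue hA h1 h2 h3.le)]
  refine syncClass_eq_iff.2 (hw.2 _ ?_).symm
  have hlang : w ++ η.map beta ∈ language (dyckShift A) := (mem_language_iff A).2 (h1 ▸ h2)
  exact ⟨mem_language_of_append_right hlang, hlang⟩

/-- The vertex map carries the edges of the Cantor horizon system exactly to the edges of the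
canonical system: a synchronizing word can be continued, without changing any of the classes
involved, until its value is that of a path. -/
lemma cantorHorizon_edge_iff (hA : ∀ i j, A i j = 0 ∨ A i j = 1) (l : ℕ) (u : plusWords A l)
    (a : Symbol N) (v : plusWords A (l + 1)) :
    ((∃ j, a = alpha j ∧ v.1 = j :: u.1) ∨
      (∃ j, a = beta j ∧ j :: v.1 ∈ plusWords A (l + 2) ∧ u.1 = (j :: v.1).take l)) ↔
    ∃ (ν : List (Symbol N)) (hν : ν ∈ syncWords (dyckShift A) (l + 1))
      (_ : [a] ∈ predecessors (dyckShift A) 1 ν)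
      (h : a :: ν ∈ syncWords (dyckShift A) l),
      vertexClass hA l u = syncClass (dyckShift A) l (a :: ν) h ∧
        vertexClass hA (l + 1) v = syncClass (dyckShift A) (l + 1) ν hν := by
  have hpred : ∀ ν : List (Symbol N), [a] ∈ predecessors (dyckShift A) 1 ν ↔
      wordValue A (a :: ν) ≠ 0 := by
    intro ν
    rw [mem_predecessors_iff, mem_language_iff]
    simp
  constructor
  · -- One extra letter keeps the path nonempty when its first letter is cancelled.
    obtain ⟨ρ, h1, h2⟩ := exists_append_mem_plusWords v.2 1
    have hv := ((mem_plusWords_iff A).1 v.2).2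
    have hρ := ((mem_plusWords_iff A).1 h2).1
    have hval := wordValue_map_beta A (v.1 ++ ρ)
    have hs := mem_syncWords_of_wordValue (l := l + 1) hA hval hρ (by simp [hv])
    intro hedge
    suffices hsuff : ∃ ξ, wordValue A (a :: (v.1 ++ ρ).map beta) = pathValue A ξ ∧
        pathValue A ξ ≠ 0 ∧ l ≤ ξ.length ∧ u.1 = ξ.take l by
      obtain ⟨ξ, h3, h4, h5, h6⟩ := hsuff
      exact ⟨(v.1 ++ ρ).map beta, hs, (hpred _).2 (h3 ▸ h4), mem_syncWords_of_wordValue hA h3 h4 h5,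
        vertexClass_eq_syncClass hA h3 h4 h5 h6 _,
        vertexClass_eq_syncClass hA hval hρ (by simp [hv]) (List.take_left' hv).symm _⟩
    rcases hedge with ⟨j, rfl, hj⟩ | ⟨j, rfl, hj, hu⟩
    · have hul := ((mem_plusWords_iff A).1 u.2).2
      rw [hj, List.cons_append] at hρ
      refine ⟨u.1 ++ ρ, ?_, ?_, by simp [hul], (List.take_left' hul).symm⟩
      · rw [wordValue_cons, wordValue_map_beta, hj, List.cons_append]
        exact star_gen_mul_pathValue hA (List.ne_nil_of_length_pos (by simp [h1])) hρ
      · rw [pathValue_cons] at hρ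
        exact right_ne_zero_of_mul hρ
    · refine ⟨j :: (v.1 ++ ρ), ?_, cons_mem_plusWords (m := l) hA (l := l + 2) ?_ hρ,
        by simp [hv]; omega, ?_⟩
      · rw [wordValue_cons, wordValue_map_beta, pathValue_cons]
        rfl
      · rwa [List.take_left' hv]
      · rw [hu, ← List.cons_append, List.take_append_of_le_length (by simp [hv]; omega)]
  · rintro ⟨ν, hν, ha, h, hu, hv⟩
    obtain ⟨η, ξ, -, h1, h2, h3⟩ := exists_append_beta hA ((mem_language_iff A).1 hν.1) (l + 1)
    have hfol : η.map beta ∈ followers (dyckShift A) ν := by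
      have hlang : ν ++ η.map beta ∈ language (dyckShift A) := (mem_language_iff A).2 (h1 ▸ h2)
      exact ⟨mem_language_of_append_right hlang, hlang⟩
    have hν1 : ν ∈ syncWords (dyckShift A) 1 := by
      have hle : ∀ m, ν ∈ syncWords (dyckShift A) (m + 1) → ν ∈ syncWords (dyckShift A) 1 := by
        intro m
        induction m with
        | zero => exact id
        | succ m ih => exact fun hm => ih (syncWords_succ_subset _ _ hm)
      exact hle l hν
    have ha' := ha
    rw [hν1.2 _ hfol, hpred, wordValue_cons, h1] at ha'
    have hvξ : v.1 = ξ.take (l + 1) := by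
      refine eq_of_predecessors_eq v.2 (take_mem_plusWords_of_ne_zero h2 h3.le) ?_
      rw [← predecessors_of_wordValue hA h1 h2 h3.le, ← hν.2 _ hfol]
      exact syncClass_eq_iff.1 hv
    have huξ : ∀ ζ : List (Fin N), phi A a * pathValue A ξ = pathValue A ζ → l ≤ ζ.length →
        u.1 = ζ.take l := by
      intro ζ h4 h5
      have h6 : wordValue A (a :: ν ++ η.map beta) = pathValue A ζ := by
        rw [List.cons_append, wordValue_cons, h1, h4]
      have h7 : pathValue A ζ ≠ 0 := h4 ▸ ha'
      refine eq_of_predecessors_eq u.2 (take_mem_plusWords_of_ne_zero h7 h5) ?_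
      rw [← predecessors_of_wordValue hA h6 h7 h5, ← h.2 _ ⟨hfol.1, ?_⟩]
      · exact syncClass_eq_iff.1 hu
      · rw [mem_language_iff, h6]
        exact h7
    rcases phi_mul_pathValue hA (by omega) ha' with ⟨j, rfl, h4⟩ | ⟨j, ρ, rfl, rfl, h4⟩
    · refine Or.inr ⟨j, rfl, ?_, ?_⟩
      · rw [hvξ, ← List.take_succ_cons]
        exact take_mem_plusWords_of_ne_zero (h4 ▸ ha') (by simp; omega)
      · rw [huξ _ h4 (by simp; omega), hvξ, ← List.take_succ_cons, List.take_take]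
        congr 1
        omega
    · refine Or.inl ⟨j, rfl, ?_⟩
      rw [hvξ, huξ _ h4 (by simp at h3; omega), List.take_succ_cons]

/-- The isomorphism of the Cantor horizon system with the canonical system of `D_A`. -/
noncomputable def cantorHorizonIso (hA : ∀ i j, A i j = 0 ∨ A i j = 1) :
    (cantorHorizon A).Iso (syncGraph (dyckShift A)) where
  onV l := Equiv.ofBijective _ (vertexClass_bijective hA l)
  onE l := ((Equiv.ofBijective _ (vertexClass_bijective hA l)).prodCongr
    ((Equiv.refl _).prodCongr (Equiv.ofBijective _ (vertexClass_bijective hA (l + 1))))).subtypeEquiv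
      fun e => cantorHorizon_edge_iff hA l e.1 e.2.1 e.2.2
  src_comm _ _ := rfl
  tgt_comm _ _ := rfl
  label_comm _ _ := rfl
  iota_comm l v := by
    have hv := (mem_plusWords_iff A).1 v.2
    exact (vertexClass_eq_syncClass hA (wordValue_map_beta A v.1) hv.1 (by omega) rfl _).symm

end MarkovDyck

theorem proposition6p4 {N : ℕ} (A : Matrix (Fin N) (Fin N) ℤ)
    (hA : ∀ i j, A i j = 0 ∨ A i j = 1) :
    SubshiftWords.LambdaSyncCondition (MarkovDyck.dyckShift A) ∧
    (A.IsIrreducible → SubshiftWords.IsLambdaSynchronizing (MarkovDyck.dyckShift A)) ∧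
    (SubshiftWords.syncGraph (MarkovDyck.dyckShift A)).IsLambdaGraphSystem ∧
    (MarkovDyck.cantorHorizon A).IsLambdaGraphSystem ∧
    (MarkovDyck.cantorHorizon A).Presents (MarkovDyck.dyckShift A) ∧
    ∃ Φ : (MarkovDyck.cantorHorizon A).Iso (SubshiftWords.syncGraph (MarkovDyck.dyckShift A)),
      ∀ (l : ℕ) (μ : MarkovDyck.plusWords A l),
        ∃ h : μ.1.map MarkovDyck.beta ∈ SubshiftWords.syncWords (MarkovDyck.dyckShift A) l,
          Φ.onV l μ =
            SubshiftWords.syncClass (MarkovDyck.dyckShift A) l (μ.1.map MarkovDyck.beta) h :=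
  ⟨MarkovDyck.lambdaSyncCondition_dyckShift hA,
    fun hirr => ⟨MarkovDyck.isIrreducibleSubshift_dyckShift hA hirr,
      MarkovDyck.lambdaSyncCondition_dyckShift hA⟩,
    (MarkovDyck.isLambdaGraphSystem_cantorHorizon hA).of_iso (MarkovDyck.cantorHorizonIso hA),
    MarkovDyck.isLambdaGraphSystem_cantorHorizon hA,
    MarkovDyck.presents_cantorHorizon hA,
    MarkovDyck.cantorHorizonIso hA, fun _ _ => ⟨_, rfl⟩⟩
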